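/- Let $N\ge 2$, let $\Omega\subset\mathbb{R}^N$ be a bounded open set with Lipschitz boundary and outer unit normal $\nu$, let $T>0$, $f\in L^1(0,T;L^2(\Omega))$ and $u_0\in L^2(\Omega)$. Put $X=BV(\Omega)\cap L^2(\Omega)$, with its natural norm. **Conventions.** $L^1_w(0,T;X)$ is the set of weakly measurable $U:(0,T)\to X$ with $\int_0^T\|U(t)\|_X\,dt<\infty$; $L^1(0,T;X)$ is the set of those $U$ that are moreover Pettis integrable (all Bochner integrable maps are included). The dual $L^1(0,T;X)^*$ is identified with the space of weakly-$*$ measurable, essentially bounded maps $\zeta:(0,T)\to X^*$. For $\xi=\zeta+g$ with $\zeta\in L^1(0,T;X)^*$ and $g\in L^1(0,T;L^2(\Omega))$ write $\langle\!\langle\xi(t),v\rangle\!\rangle=\langle\zeta(t),v\rangle+\int_\Omega g(t)v\,dx$ for $v\in X$. **Time derivative.** $\xi\in L^1(0,T;X)^*+L^1(0,T;L^2(\Omega))$ is the time derivative of $u$ if $$\int_0^T\langle\!\langle\xi(t),\Psi(t)\rangle\!\rangle\,dt=-\int_0^T\int_\Omega u(t)\,\Theta(t)\,dx\,dt$$ for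 every $\Psi\in L^1(0,T;X)\cap L^\infty(0,T;L^2(\Omega))$ with compact support in $(0,T)$ such that $\Psi(t)=\int_0^t\Theta(s)\,ds$ (Pettis integral in $X$) for all $t\in[0,T]$, for some $\Theta\in L^1_w(0,T;X)$. **Solution.** $u$ is a solution, with time derivative $\xi$, of $u'-\Delta_1u=f$ in $(0,T)\times\Omega$, $u=0$ on $(0,T)\times\partial\Omega$, $u(0)=u_0$, if $u\in C([0,T];L^2(\Omega))\cap L^1(0,T;X)$, $u(0)=u_0$, $\xi\in L^1(0,T;X)^*+L^1(0,T;L^2(\Omega))$ is the time derivative of $u$, and there is $\mathbf z\in L^\infty((0,T)\times\Omega;\mathbb{R}^N)$ with $\|\mathbf z\|_\infty\le1$ whose distributional (spatial) divergence has an extension $\rho\in L^1(0,T;X)^*$ such that for almost every $t\in(0,T)$: * the weak normal trace $[\mathbf z(t),\nu]\in L^\infty(\partial\Omega)$ is well defined by $\langle\rho(t),v\rangle+\int_\Omega\mathbf z(t)\cdot\nabla v\,dx=\int_{\partial\Omega}v\,[\mathbf z(t),\nu]\,d\mathcal H^{N-1}$ for all $v\in W^{1,1}(\Omega)\cap L^\infty(\Omega)$,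 and $\|[\mathbf z(t),\nu]\|_\infty\le1$; * for every $v\in X$ the distribution $\langle(\mathbf z(t),Dv),\omega\rangle=-\langle\rho(t),v\omega\rangle-\int_\Omega v\,\mathbf z(t)\cdot\nabla\omega\,dx$, $\omega\in C_0^\infty(\Omega)$, is a finite Radon measure, and $\langle\rho(t),v\rangle+\int_\Omega(\mathbf z(t),Dv)=\int_{\partial\Omega}v\,[\mathbf z(t),\nu]\,d\mathcal H^{N-1}$; * $\xi(t)=\operatorname{div}\mathbf z(t)+f(t)$ in $\mathcal D'(\Omega)$; $(\mathbf z(t),Du(t))=|Du(t)|$ as measures in $\Omega$; $[\mathbf z(t),\nu]\in\operatorname{sign}(-u(t))$ $\mathcal H^{N-1}$-a.e. on $\partial\Omega$; and $\langle\!\langle\xi(t),u(t)\rangle\!\rangle=\frac12\left(\int_\Omega u(t)^2\,dx\right)'$ in the sense of distributions on $(0,T)$. **Claim.** Let $u$ be a solution with time derivative $\xi$, and let $\eta\in C_0^\infty(0,T)$ be nonnegative; extend $\eta u$ by $0$ outside $(0,T)$. For every $\varepsilon>0$ and $t\in(0,T)$ the function $\eta u$ is Pettis integrable in $X$ on $(t-\varepsilon,t)$,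 the function $t\mapsto\big\langle\!\big\langle\xi(t),\frac1\varepsilon\int_{t-\varepsilon}^t\eta(s)u(s)\,ds\big\rangle\!\big\rangle$ is integrable on $(0,T)$, and $$\lim_{\varepsilon\to0^+}\int_0^T\Big\langle\!\!\Big\langle\xi(t),\frac1\varepsilon\int_{t-\varepsilon}^t\eta(s)u(s)\,ds\Big\rangle\!\!\Big\rangle\,dt=-\int_0^T\eta'(t)\int_\Omega\tfrac12u(t)^2\,dx\,dt .$$ -/

import Mathlib

open MeasureTheory Set Filter Topology TopologicalSpace Distributions
open scoped NNReal ENNReal Gradient InnerProductSpace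

noncomputable section

namespace TVFlow

/-- The Euclidean space `ℝ^N`. -/
abbrev E (N : ℕ) : Type := EuclideanSpace ℝ (Fin N)

variable {N : ℕ}

/-- Lebesgue measure on `Ω`. -/
abbrev volOn (Ω : Opens (E N)) : Measure (E N) := volume.restrict (Ω : Set (E N))

/-- The space `L²(Ω)`. -/
abbrev L2 (Ω : Opens (E N)) : Type := Lp ℝ 2 (volOn Ω)

/-- The open time interval `(0,T)`, as an open set. -/
def timeInterval (T : ℝ) : Opens ℝ := ⟨Ioo 0 T, isOpen_Ioo⟩

/-- The surface measure: the `(N-1)`-dimensional Hausdorff measure, with the Euclidean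
normalization, on the boundary of `Ω`. -/
def bdryMeasure (Ω : Opens (E N)) : Measure (E N) :=
  (Measure.euclideanHausdorffMeasure (N - 1)).restrict (frontier (Ω : Set (E N)))

/-- `Ω` has Lipschitz boundary: near each boundary point `Ω` is, in suitable orthogonal coordinates
(with last axis `n`), the set of points strictly above the graph of a Lipschitz function. -/
def HasLipschitzBoundary (Ω : Opens (E N)) : Prop :=
  ∀ x ∈ frontier (Ω : Set (E N)), ∃ n : E N, ‖n‖ = 1 ∧ ∃ r > 0, ∃ (K : ℝ≥0)
    (g : (Submodule.span ℝ {n})ᗮ → ℝ), LipschitzWith K g ∧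
      ∀ y ∈ Metric.ball x r,
        (y ∈ Ω ↔ g ((Submodule.span ℝ {n})ᗮ.orthogonalProjectionOnto y) < ⟪n, y⟫_ℝ)

/-! ### Functions of bounded variation -/

/-- The `ℝ^N`-valued measure `D` on `Ω` (a measure on `ℝ^N` concentrated on `Ω`) has finite total
variation and is the distributional gradient of `v` in `Ω`. -/
structure IsGradMeasure (Ω : Opens (E N)) (v : E N → ℝ) (D : VectorMeasure (E N) (E N)) :
    Prop where
  finite : IsFiniteMeasure D.variation
  concentrated : ∀ A, MeasurableSet A → D A = D (A ∩ Ω)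
  integral_eq : ∀ φ : 𝓓(Ω, ℝ), ∫ x in (Ω : Set (E N)), v x • ∇ φ x = - ∫ᵛ x, φ x ∂•D

lemma integrable_test {Ω : Opens (E N)} {D : VectorMeasure (E N) (E N)}
    (hD : IsFiniteMeasure D.variation) (φ : 𝓓(Ω, ℝ)) : D.Integrable φ :=
  φ.continuous.integrable_of_hasCompactSupport φ.hasCompactSupport

lemma exists_test_tendsto {Ω : Opens (E N)} {K : Set (E N)} (hK : IsCompact K)
    (hKΩ : K ⊆ Ω) : ∃ φ : ℕ → 𝓓(Ω, ℝ), (∀ n x, ‖φ n x‖ ≤ 1) ∧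
      ∀ x, Tendsto (fun n => φ n x) atTop (𝓝 (K.indicator (fun _ => (1 : ℝ)) x)) := by
  obtain ⟨δ, δpos, hδ⟩ := hK.exists_cthickening_subset_open Ω.isOpen hKΩ
  obtain ⟨u, -, u_pos, u_lim⟩ : ∃ u, StrictAnti u ∧ (∀ (n : ℕ), u n ∈ Ioo 0 δ)
    ∧ Tendsto u atTop (𝓝 0) := exists_seq_strictAnti_tendsto' δpos
  have key : ∀ n, ∃ φ : 𝓓(Ω, ℝ), (∀ x, ‖φ x‖ ≤ 1) ∧ (∀ x ∈ K, φ x = 1) ∧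
      ∀ x, x ∉ Metric.thickening (u n) K → φ x = 0 := by
    intro n
    rcases exists_contMDiff_support_eq_eq_one_iff (modelWithCornersSelf ℝ (E N)) (n := (⊤ : ℕ∞))
      (Metric.isOpen_thickening (δ := u n) (E := K)) hK.isClosed
      (Metric.self_subset_thickening (u_pos n).1 K) with ⟨g, g_smooth, g_range, g_supp, hg⟩
    have hsub : tsupport g ⊆ Metric.cthickening δ K := by
      refine closure_minimal ?_ Metric.isClosed_cthickening
      rw [g_supp]
      exact Metric.thickening_subset_cthickening_of_le (u_pos n).2.le _
    refine ⟨⟨g, contMDiff_iff_contDiff.1 g_smooth,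
      hK.cthickening.of_isClosed_subset (isClosed_tsupport g) hsub, hsub.trans hδ⟩, ?_, ?_, ?_⟩
    · intro x
      have := g_range (mem_range_self x)
      change ‖g x‖ ≤ 1
      rw [Real.norm_of_nonneg this.1]
      exact this.2
    · exact fun x hx => (hg x).1 hx
    · intro x hx
      change g x = 0
      rwa [← Function.notMem_support, g_supp]
  choose φ h1 h2 h3 using key
  refine ⟨φ, h1, fun x => ?_⟩
  by_cases hx : x ∈ K
  · simp [hx, h2 _ x hx]
  · simp only [hx, not_false_eq_true, indicator_of_notMem]
    apply tendsto_const_nhds.congr'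
    obtain ⟨ε, εpos, hε⟩ : ∃ ε, 0 < ε ∧ x ∉ Metric.thickening ε K := by
      rw [← hK.isClosed.closure_eq, Metric.closure_eq_iInter_thickening] at hx
      simpa using hx
    filter_upwards [(tendsto_order.1 u_lim).2 _ εpos] with n hn
    exact (h3 n x fun h => hε (Metric.thickening_mono hn.le K h)).symm

/-- The distributional gradient is unique. -/
lemma IsGradMeasure.unique {Ω : Opens (E N)} {v : E N → ℝ} {D₁ D₂ : VectorMeasure (E N) (E N)}
    (h₁ : IsGradMeasure Ω v D₁) (h₂ : IsGradMeasure Ω v D₂) : D₁ = D₂ := by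
  have hcomp : ∀ K : Set (E N), IsCompact K → K ⊆ Ω → D₁ K = D₂ K := by
    intro K hK hKΩ
    obtain ⟨φ, hb, hl⟩ := exists_test_tendsto hK hKΩ
    have lim : ∀ D : VectorMeasure (E N) (E N), IsGradMeasure Ω v D →
        Tendsto (fun n => - ∫ x in (Ω : Set (E N)), v x • ∇ (φ n) x) atTop (𝓝 (D K)) := by
      intro D h
      have := h.finite
      have h0 : ∫ᵛ x, K.indicator (fun _ => (1 : ℝ)) x ∂•D = D K := by
        rw [VectorMeasure.integral_indicator hK.measurableSet, VectorMeasure.integral_const]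
        simp
      simp_rw [h.integral_eq, neg_neg]
      rw [← h0]
      exact VectorMeasure.tendsto_integral_of_dominated_convergence (fun _ => (1 : ℝ))
        (fun n => (φ n).continuous.aestronglyMeasurable) (integrable_const _)
        (fun n => Eventually.of_forall (hb n)) (Eventually.of_forall hl)
    exact tendsto_nhds_unique (lim D₁ h₁) (lim D₂ h₂)
  have hclosed : ∀ F : Set (E N), IsClosed F → D₁ F = D₂ F := by
    intro F hF
    obtain ⟨C, hCc, hCs, hCu, hCm⟩ := Ω.isOpen.exists_iUnion_isClosed
    set K : ℕ → Set (E N) := fun n => F ∩ (C n ∩ Metric.closedBall 0 n) with hKdef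
    have hKc : ∀ n, IsCompact (K n) := fun n =>
      ((isCompact_closedBall 0 (n : ℝ)).inter_left (hCc n)).inter_left hF
    have hKm : Monotone K := by
      intro m n hmn
      have : (m : ℝ) ≤ n := by exact_mod_cast hmn
      exact inter_subset_inter_right _
        (inter_subset_inter (hCm hmn) (Metric.closedBall_subset_closedBall this))
    have hKu : ⋃ n, K n = F ∩ Ω := by
      ext x
      simp only [hKdef, mem_iUnion, mem_inter_iff, Metric.mem_closedBall, dist_zero_right]
      constructor
      · rintro ⟨n, h1, h2, -⟩
        exact ⟨h1, hCs n h2⟩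
      · rintro ⟨h1, h2⟩
        rw [← hCu] at h2
        obtain ⟨m, hm⟩ := mem_iUnion.1 h2
        obtain ⟨k, hk⟩ := exists_nat_ge ‖x‖
        refine ⟨max m k, h1, hCm (le_max_left _ _) hm, hk.trans ?_⟩
        exact_mod_cast le_max_right _ _
    rw [h₁.concentrated F hF.measurableSet, h₂.concentrated F hF.measurableSet, ← hKu]
    have l1 := D₁.tendsto_vectorMeasure_iUnion_atTop_nat hKm (fun n => (hKc n).measurableSet)
    have l2 := D₂.tendsto_vectorMeasure_iUnion_atTop_nat hKm (fun n => (hKc n).measurableSet)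
    refine tendsto_nhds_unique l1 (l2.congr fun n => ?_)
    exact (hcomp _ (hKc n) fun x hx => hCs n hx.2.1).symm
  exact VectorMeasure.ext_of_generateFrom {s | IsClosed s} (fun s hs => hclosed s hs)
    (by rw [← borel_eq_generateFrom_isClosed]; exact BorelSpace.measurable_eq)
    isPiSystem_isClosed (hclosed _ isClosed_univ)

lemma integrable_smul_gradient {Ω : Opens (E N)} (v : L2 Ω) (φ : 𝓓(Ω, ℝ)) :
    Integrable (fun x => v x • ∇ φ x) (volOn Ω) := by
  have hc : Continuous (∇ φ) :=
    (InnerProductSpace.toDual ℝ (E N)).symm.continuous.comp (φ.contDiff.continuous_fderiv (by simp))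
  have hs : HasCompactSupport (∇ φ) :=
    (φ.hasCompactSupport.fderiv ℝ).comp_left (g := (InnerProductSpace.toDual ℝ (E N)).symm)
      (map_zero _)
  have h2 : MemLp (∇ φ) 2 (volOn Ω) := hc.memLp_of_hasCompactSupport hs
  exact memLp_one_iff_integrable.1 (h2.smul (Lp.memLp v))

lemma IsGradMeasure.zero (Ω : Opens (E N)) : IsGradMeasure Ω ((0 : L2 Ω) : E N → ℝ) 0 where
  finite := by rw [VectorMeasure.variation_zero]; infer_instance
  concentrated A _ := by simp
  integral_eq φ := by
    rw [VectorMeasure.integral_zero_vectorMeasure, neg_zero]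
    refine integral_eq_zero_of_ae ?_
    filter_upwards [Lp.coeFn_zero ℝ 2 (volOn Ω)] with x hx
    rw [hx]
    exact zero_smul ℝ _

lemma IsGradMeasure.add {Ω : Opens (E N)} {v w : L2 Ω} {D₁ D₂ : VectorMeasure (E N) (E N)}
    (h₁ : IsGradMeasure Ω v D₁) (h₂ : IsGradMeasure Ω w D₂) :
    IsGradMeasure Ω (v + w : L2 Ω) (D₁ + D₂) where
  finite := by
    have := h₁.finite
    have := h₂.finite
    exact isFiniteMeasure_of_le _ VectorMeasure.variation_add_le
  concentrated A hA := by
    simp only [_root_.add_apply]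
    rw [h₁.concentrated A hA, h₂.concentrated A hA]
  integral_eq φ := by
    rw [VectorMeasure.integral_add_vectorMeasure (integrable_test h₁.finite φ)
      (integrable_test h₂.finite φ), neg_add, ← h₁.integral_eq, ← h₂.integral_eq,
      ← integral_add (integrable_smul_gradient v φ) (integrable_smul_gradient w φ)]
    refine integral_congr_ae ?_
    filter_upwards [Lp.coeFn_add v w] with x hx
    rw [hx]
    exact add_smul _ _ _

lemma IsGradMeasure.smul {Ω : Opens (E N)} {v : L2 Ω} {D : VectorMeasure (E N) (E N)} (c : ℝ)
    (h : IsGradMeasure Ω v D) : IsGradMeasure Ω (c • v : L2 Ω) (c • D) where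
  finite := by
    have := h.finite
    infer_instance
  concentrated A hA := by
    simp only [_root_.smul_apply]
    rw [h.concentrated A hA]
  integral_eq φ := by
    rw [VectorMeasure.integral_smul_vectorMeasure, ← smul_neg, ← h.integral_eq, ← integral_smul]
    refine integral_congr_ae ?_
    filter_upwards [Lp.coeFn_smul c v] with x hx
    rw [hx]
    exact mul_smul c (v x) _

/-- `BV(Ω) ∩ L²(Ω)` as a linear subspace of `L²(Ω)` (for bounded `Ω`, every function in `L²(Ω)` is
integrable). -/
def bvSubmodule (Ω : Opens (E N)) : Submodule ℝ (L2 Ω) where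
  carrier := {v | ∃ D, IsGradMeasure Ω v D}
  zero_mem' := ⟨0, IsGradMeasure.zero Ω⟩
  add_mem' := fun ⟨_, h₁⟩ ⟨_, h₂⟩ => ⟨_, h₁.add h₂⟩
  smul_mem' := fun c _ ⟨_, h⟩ => ⟨_, h.smul c⟩

/-- The space `BV(Ω) ∩ L²(Ω)`, which gets its own norm below. -/
def BVL2 (Ω : Opens (E N)) : Type := bvSubmodule Ω

namespace BVL2

variable {Ω : Opens (E N)}

instance : AddCommGroup (BVL2 Ω) := inferInstanceAs (AddCommGroup (bvSubmodule Ω))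
instance : Module ℝ (BVL2 Ω) := inferInstanceAs (Module ℝ (bvSubmodule Ω))

/-- The inclusion of `BV(Ω) ∩ L²(Ω)` in `L²(Ω)`. -/
def toL2 : BVL2 Ω →ₗ[ℝ] L2 Ω := (bvSubmodule Ω).subtype

/-- The distributional gradient `Dv`, an `ℝ^N`-valued measure. -/
def grad (v : BVL2 Ω) : VectorMeasure (E N) (E N) := v.2.choose

lemma isGradMeasure_grad (v : BVL2 Ω) : IsGradMeasure Ω (toL2 v) (grad v) := v.2.choose_spec

lemma grad_eq {v : BVL2 Ω} {D : VectorMeasure (E N) (E N)} (h : IsGradMeasure Ω (toL2 v) D) :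
    grad v = D := (isGradMeasure_grad v).unique h

/-- The total variation measure `|Dv|`. -/
def tv (v : BVL2 Ω) : Measure (E N) := (grad v).variation

instance (v : BVL2 Ω) : IsFiniteMeasure (tv v) := (isGradMeasure_grad v).finite

/-- The norm `‖v‖ = |Dv|(Ω) + ‖v‖_{L²(Ω)}`; for bounded `Ω` it is equivalent to
`max {|Dv|(Ω) + ‖v‖_{L¹(Ω)}, ‖v‖_{L²(Ω)}}`. -/
instance : Norm (BVL2 Ω) := ⟨fun v => (tv v).real Ω + ‖toL2 v‖⟩

lemma norm_def (v : BVL2 Ω) : ‖v‖ = (tv v).real Ω + ‖toL2 v‖ := rfl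

lemma normCore : NormedSpace.Core ℝ (BVL2 Ω) where
  norm_nonneg v := by rw [norm_def]; positivity
  norm_smul c v := by
    have h : grad (c • v) = c • grad v := by
      apply grad_eq
      rw [map_smul]
      exact (isGradMeasure_grad v).smul c
    rw [norm_def, norm_def, map_smul, norm_smul, mul_add, tv, tv, h, VectorMeasure.variation_smul]
    simp [Measure.real]
  norm_triangle v w := by
    have h : grad (v + w) = grad v + grad w := by
      apply grad_eq
      rw [map_add]
      exact (isGradMeasure_grad v).add (isGradMeasure_grad w)
    have h1 : (tv (v + w)).real Ω ≤ (tv v).real Ω + (tv w).real Ω := by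
      rw [← measureReal_add_apply]
      refine ENNReal.toReal_mono (measure_ne_top _ _) ?_
      rw [tv, h]
      exact VectorMeasure.variation_add_le _
    have h2 := norm_add_le (toL2 v) (toL2 w)
    rw [norm_def, norm_def, norm_def, map_add]
    linarith
  norm_eq_zero_iff v := by
    constructor
    · intro h
      rw [norm_def] at h
      have h0 : 0 ≤ (tv v).real Ω := measureReal_nonneg
      have h1 : ‖toL2 v‖ = 0 := le_antisymm (by linarith) (norm_nonneg _)
      exact Subtype.ext (norm_eq_zero.1 h1)
    · rintro rfl
      have h : grad (0 : BVL2 Ω) = 0 := by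
        apply grad_eq
        rw [map_zero]
        exact IsGradMeasure.zero Ω
      rw [norm_def, map_zero, tv, h]
      simp

instance : NormedAddCommGroup (BVL2 Ω) := NormedAddCommGroup.ofCore normCore
instance : NormedSpace ℝ (BVL2 Ω) := NormedSpace.ofCore normCore

end BVL2

open BVL2

/-- The element of `BV(Ω) ∩ L²(Ω)` that is a.e. equal to the given function on `Ω` (and `0` if the
function does not belong to that space). -/
def toBV (Ω : Opens (E N)) (f : E N → ℝ) : BVL2 Ω :=
  open Classical in if h : ∃ v : BVL2 Ω, toL2 v =ᵐ[volOn Ω] f then h.choose else 0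

/-- The trace on `∂Ω`: for functions of bounded variation on a bounded Lipschitz domain the limit
of averages exists at almost every boundary point. -/
def bdryTrace (Ω : Opens (E N)) (v : E N → ℝ) (x : E N) : ℝ :=
  limUnder (𝓝[>] (0 : ℝ)) fun r => ⨍ y in (Ω : Set (E N)) ∩ Metric.ball x r, v y

/-- `G` is the weak gradient of `v` in `Ω`, and it is integrable. -/
def HasIntegrableWeakGradient (Ω : Opens (E N)) (v : E N → ℝ) (G : E N → E N) : Prop :=
  IntegrableOn G Ω ∧
    ∀ φ : 𝓓(Ω, ℝ), ∫ x in (Ω : Set (E N)), v x • ∇ φ x = - ∫ x in (Ω : Set (E N)), φ x • G x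

/-! ### Integration of vector-valued functions of time -/

section Pettis

variable {X : Type*} [NormedAddCommGroup X] [NormedSpace ℝ X]

/-- `v` is the Pettis integral of `U` over `S`. -/
def HasPettisIntegral (U : ℝ → X) (S : Set ℝ) (v : X) : Prop :=
  ∀ l : StrongDual ℝ X, IntegrableOn (fun t => l (U t)) S ∧ ∫ t in S, l (U t) = l v

/-- `U` is Pettis integrable on `S`. -/
def PettisIntegrableOn (U : ℝ → X) (S : Set ℝ) : Prop :=
  ∀ A, MeasurableSet A → A ⊆ S → ∃ v, HasPettisIntegral U A v

/-- The Pettis integral of `U` over `S` (and `0` if there is none). -/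
def pettisIntegral (U : ℝ → X) (S : Set ℝ) : X :=
  open Classical in if h : ∃ v, HasPettisIntegral U S v then h.choose else 0

/-- `U` is a weakly measurable map on `(0,T)` with `∫₀ᵀ ‖U(t)‖ dt < ∞`. -/
def MemL1w (T : ℝ) (U : ℝ → X) : Prop :=
  (∀ l : StrongDual ℝ X, AEMeasurable (fun t => l (U t)) (volume.restrict (Ioo 0 T))) ∧
    ∫⁻ t in Ioo 0 T, ‖U t‖ₑ < ∞

/-- `U` is a weakly measurable and Pettis integrable map on `(0,T)` with `∫₀ᵀ ‖U(t)‖ dt < ∞`.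
Every Bochner integrable map satisfies this. -/
def MemL1 (T : ℝ) (U : ℝ → X) : Prop := MemL1w T U ∧ PettisIntegrableOn U (Ioo 0 T)

/-- `ζ ∈ L^∞_{w*}(0,T;X*)`, which is the dual of `L¹(0,T;X)`: `ζ` is weakly-* measurable and
essentially bounded. -/
def MemDualL1 (T : ℝ) (ζ : ℝ → StrongDual ℝ X) : Prop :=
  (∀ v : X, AEMeasurable (fun t => ζ t v) (volume.restrict (Ioo 0 T))) ∧
    ∃ C : ℝ, ∀ᵐ t ∂volume.restrict (Ioo 0 T), ‖ζ t‖ ≤ C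

/-- `Θ` is the weak derivative of `Ψ` on `[0,T]`: `Ψ(t) = ∫₀ᵗ Θ(s) ds` as a Pettis integral. -/
def IsWeakDerivative (T : ℝ) (Ψ Θ : ℝ → X) : Prop :=
  MemL1w T Θ ∧ PettisIntegrableOn Θ (Ioo 0 T) ∧
    ∀ t ∈ Icc 0 T, HasPettisIntegral Θ (Ioo 0 t) (Ψ t)

end Pettis

/-- `ξ` belongs to `L¹(0,T;BV(Ω) ∩ L²(Ω))* + L¹(0,T;L²(Ω))`. The element `ξ(t) = ζ(t) + g(t)` acts on
`v` by `⟨ζ(t), v⟩ + ∫_Ω g(t) v dx`. -/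
def MemDualL1AddL1 (Ω : Opens (E N)) (T : ℝ) (ξ : ℝ → StrongDual ℝ (BVL2 Ω)) : Prop :=
  ∃ (ζ : ℝ → StrongDual ℝ (BVL2 Ω)) (g : ℝ → L2 Ω), MemDualL1 T ζ ∧ IntegrableOn g (Ioo 0 T) ∧
    ∀ᵐ t ∂volume.restrict (Ioo 0 T), ∀ v : BVL2 Ω,
      ξ t v = ζ t v + ∫ x in (Ω : Set (E N)), g t x * toL2 v x

/-- `ξ` is the time derivative of `u`: for every test function `Ψ` with compact support in time
which admits a weak derivative `Θ`, one has `∫₀ᵀ ⟨⟨ξ, Ψ⟩⟩ dt = - ∫₀ᵀ ∫_Ω u Θ dx dt`. -/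
def IsTimeDerivative (Ω : Opens (E N)) (T : ℝ) (u : ℝ → L2 Ω) (ξ : ℝ → StrongDual ℝ (BVL2 Ω)) :
    Prop :=
  ∀ Ψ Θ : ℝ → BVL2 Ω, MemL1 T Ψ →
    (∃ C : ℝ, ∀ᵐ t ∂volume.restrict (Ioo 0 T), ‖toL2 (Ψ t)‖ ≤ C) →
    (∃ a b : ℝ, 0 < a ∧ b < T ∧ ∀ t ∈ Icc 0 T, t ∉ Icc a b → Ψ t = 0) →
    IsWeakDerivative T Ψ Θ →
    ∫ t in Ioo 0 T, ξ t (Ψ t) =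
      - ∫ t in Ioo 0 T, ∫ x in (Ω : Set (E N)), u t x * toL2 (Θ t) x

/-! ### Solutions of the `1`-Laplace evolution equation -/

/-- The multivalued sign. -/
def signSet (s : ℝ) : Set ℝ :=
  {a | (0 < s → a = 1) ∧ (s < 0 → a = -1) ∧ |a| ≤ 1}

/-- The distribution `(z, Dv)` when the divergence of `z` is extended to `ρ ∈ (BV(Ω) ∩ L²(Ω))*`:
`⟨(z, Dv), ω⟩ = - ⟨ρ, v ω⟩ - ∫_Ω v z · ∇ω dx`. -/
def pairing (Ω : Opens (E N)) (z : E N → E N) (ρ : StrongDual ℝ (BVL2 Ω)) (v : BVL2 Ω)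
    (ω : 𝓓(Ω, ℝ)) : ℝ :=
  - ρ (toBV Ω fun x => toL2 v x * ω x) - ∫ x in (Ω : Set (E N)), toL2 v x * ⟪z x, ∇ ω x⟫_ℝ

/-- `γ = [z, ν]` is the weak trace on `∂Ω` of the normal component of `z`, when the divergence of `z`
is extended to `ρ`: `⟨ρ, v⟩ + ∫_Ω z · ∇v dx = ∫_{∂Ω} v γ` for all `v ∈ W^{1,1}(Ω) ∩ L^∞(Ω)`. -/
def IsNormalTrace (Ω : Opens (E N)) (z : E N → E N) (ρ : StrongDual ℝ (BVL2 Ω)) (γ : E N → ℝ) :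
    Prop :=
  MemLp γ ∞ (bdryMeasure Ω) ∧
    ∀ (v : BVL2 Ω) (G : E N → E N), MemLp (toL2 v) ∞ (volOn Ω) →
      HasIntegrableWeakGradient Ω (toL2 v) G →
      ρ v + ∫ x in (Ω : Set (E N)), ⟪z x, G x⟫_ℝ = ∫ x, bdryTrace Ω (toL2 v) x * γ x ∂bdryMeasure Ω

/-- `z`, with divergence extended to `ρ` and normal traces `γ`, is an admissible vector field on
`(0,T) × Ω`. -/
structure IsAdmissibleField (Ω : Opens (E N)) (T : ℝ) (z : ℝ → E N → E N)
    (ρ : ℝ → StrongDual ℝ (BVL2 Ω)) (γ : ℝ → E N → ℝ) : Prop where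
  measurable : AEStronglyMeasurable (Function.uncurry z)
    ((volume.restrict (Ioo 0 T)).prod (volOn Ω))
  norm_le : ∀ᵐ p ∂(volume.restrict (Ioo 0 T)).prod (volOn Ω), ‖Function.uncurry z p‖ ≤ 1
  memDual : MemDualL1 T ρ
  /-- `ρ` extends the distributional divergence of `z`. -/
  extends_div : ∀ᵐ t ∂volume.restrict (Ioo 0 T), ∀ φ : 𝓓(Ω, ℝ),
    ρ t (toBV Ω φ) = - ∫ x in (Ω : Set (E N)), ⟪z t x, ∇ φ x⟫_ℝ
  normalTrace : ∀ᵐ t ∂volume.restrict (Ioo 0 T), IsNormalTrace Ω (z t) (ρ t) (γ t)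
  normalTrace_le : ∀ᵐ t ∂volume.restrict (Ioo 0 T), ∀ᵐ x ∂bdryMeasure Ω, |γ t x| ≤ 1
  /-- `(z(t), Dv)` is a Radon measure `μ`, and Green's formula holds. -/
  green : ∀ᵐ t ∂volume.restrict (Ioo 0 T), ∀ v : BVL2 Ω, ∃ μ : SignedMeasure (E N),
    (∀ ω : 𝓓(Ω, ℝ), pairing Ω (z t) (ρ t) v ω = ∫ᵛ x, ω x ∂•μ) ∧
    ρ t v + μ Ω = ∫ x, bdryTrace Ω (toL2 v) x * γ t x ∂bdryMeasure Ω

/-- `u` is a solution, with time derivative `ξ`, of `u' - Δ₁ u = f` in `(0,T) × Ω`, `u = 0` on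
`(0,T) × ∂Ω`, `u(0) = u₀`. -/
structure IsSolution (Ω : Opens (E N)) (T : ℝ) (f : ℝ → L2 Ω) (u₀ : L2 Ω) (u : ℝ → L2 Ω)
    (ξ : ℝ → StrongDual ℝ (BVL2 Ω)) : Prop where
  continuousOn : ContinuousOn u (Icc 0 T)
  initial : u 0 = u₀
  mem_bv : ∀ᵐ t ∂volume.restrict (Ioo 0 T), u t ∈ bvSubmodule Ω
  memL1 : MemL1 T fun t => toBV Ω (u t)
  mem_dual : MemDualL1AddL1 Ω T ξ
  timeDerivative : IsTimeDerivative Ω T u ξ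
  exists_field : ∃ (z : ℝ → E N → E N) (ρ : ℝ → StrongDual ℝ (BVL2 Ω)) (γ : ℝ → E N → ℝ),
    IsAdmissibleField Ω T z ρ γ ∧
    -- the equation `ξ(t) = div z(t) + f(t)` in the sense of distributions
    (∀ᵐ t ∂volume.restrict (Ioo 0 T), ∀ φ : 𝓓(Ω, ℝ),
      ξ t (toBV Ω φ) = - (∫ x in (Ω : Set (E N)), ⟪z t x, ∇ φ x⟫_ℝ) +
        ∫ x in (Ω : Set (E N)), f t x * φ x) ∧
    -- `(z(t), Du(t)) = |Du(t)|` as measures in `Ω`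
    (∀ᵐ t ∂volume.restrict (Ioo 0 T), ∀ ω : 𝓓(Ω, ℝ),
      pairing Ω (z t) (ρ t) (toBV Ω (u t)) ω = ∫ x, ω x ∂tv (toBV Ω (u t))) ∧
    -- `[z(t), ν] ∈ sign(-u(t))` a.e. on `∂Ω`
    (∀ᵐ t ∂volume.restrict (Ioo 0 T), ∀ᵐ x ∂bdryMeasure Ω,
      γ t x ∈ signSet (-bdryTrace Ω (u t) x))
  /-- The function `t ↦ ⟨⟨ξ(t), u(t)⟩⟩` is the distributional derivative of
  `t ↦ (1/2) ∫_Ω u(t)² dx`. -/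
  energy : LocallyIntegrableOn (fun t => ξ t (toBV Ω (u t))) (Ioo 0 T) ∧
    ∀ φ : 𝓓(timeInterval T, ℝ),
      ∫ t in Ioo 0 T, φ t * ξ t (toBV Ω (u t)) =
        - ∫ t in Ioo 0 T, deriv φ t * ∫ x in (Ω : Set (E N)), 1 / 2 * u t x ^ 2

/-- The function `Ψ_ε(t) = (1/ε) ∫_{t-ε}^t η(s) u(s) ds`, a Pettis integral in `BV(Ω) ∩ L²(Ω)`; the
function `η u` vanishes outside `(0,T)`. -/
def backwardAverage {Ω : Opens (E N)} {T : ℝ} (η : 𝓓(timeInterval T, ℝ)) (u : ℝ → L2 Ω) (ε t : ℝ) :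
    BVL2 Ω :=
  ε⁻¹ • pettisIntegral (fun s => η s • toBV Ω (u s)) (Ioo (t - ε) t)

end TVFlow

/-! Write `V = η u`. If `V` is Bochner integrable in `X = BV(Ω) ∩ L²(Ω)`, its backward averages
converge to `V` in `L¹(0,T;X)`. Moreover `η u` is continuous with compact support as a map to
`L²(Ω)`, so the averages also converge uniformly in `L²(Ω)`. These two modes of convergence match
the two summands of `ξ = ζ + g`: the essentially bounded `ζ` is tested against `L¹` convergence in
`X`, the integrable `g` against uniform convergence in `L²(Ω)`
(`MemDualL1AddL1.tendsto_integral_apply`). The limit `∫ ⟨⟨ξ, η u⟩⟩ = ∫ η ⟨⟨ξ, u⟩⟩` is then evaluated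
by the energy identity with test function `η`.

The real issue is strong measurability, since `X` need not be separable and `u` is only assumed
Pettis integrable. Let `v q` be the Pettis integral of `u` over `(0,T) ∩ (-∞,q)` for rational `q`,
and let the finite measure `μ` dominate all `|D(v q)|`. For a Borel set `B`, the `μ`-singular part
of `Dv` evaluated at `B` is bounded and linear in `v` (`singularGrad`), so it commutes with the
Pettis integral. It vanishes at every `v q`, hence at `u t` for almost every `t`. Letting `B` run
through a countable algebra generating the Borel sets gives `D(u t) ≪ μ` for almost every `t`. Such
functions form a separable set, because a density with respect to `μ` and the function itself embed
them in `L¹(μ) × L²(Ω)`. The Pettis measurability theorem then gives Bochner integrability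
(`MemL1.integrableOn`). -/

namespace TVFlow

variable {N : ℕ} {Ω : Opens (E N)}

open BVL2

/-! ### Densities of `ℝ^N`-valued measures -/

/-- Radon-Nikodym theorem for `ℝ^N`-valued measures. -/
lemma exists_withDensityᵥ_eq {α : Type*} [MeasurableSpace α] {μ : Measure α} [SigmaFinite μ]
    {D : VectorMeasure α (E N)} (h : ∀ A, μ A = 0 → D A = 0) :
    ∃ F : α → E N, Integrable F μ ∧ μ.withDensityᵥ F = D := by
  let p (i : Fin N) : E N →L[ℝ] ℝ := EuclideanSpace.proj i
  let s (i : Fin N) : SignedMeasure α := D.mapRange (p i : E N →+ ℝ) (p i).continuous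
  have hs (i : Fin N) (A : Set α) : s i A = D A i := rfl
  have hac (i : Fin N) : s i ≪ᵥ μ.toENNRealVectorMeasure := by
    intro A hA
    by_cases hm : MeasurableSet A
    · rw [Measure.toENNRealVectorMeasure_apply_measurable hm] at hA
      rw [hs, h A hA]
      rfl
    · exact (s i).not_measurable hm
  let F : α → E N := fun x => WithLp.toLp 2 fun i => (s i).rnDeriv μ x
  have hF (i : Fin N) : Integrable (fun x => F x i) μ := SignedMeasure.integrable_rnDeriv _ _
  have hF' : Integrable F μ := Integrable.of_eval_piLp hF
  refine ⟨F, hF', ?_⟩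
  ext A hA i
  rw [withDensityᵥ_apply hF' hA, eval_integral_piLp fun i => (hF i).integrableOn, ← hs,
    ← SignedMeasure.withDensityᵥ_rnDeriv_eq (s i) μ (hac i),
    withDensityᵥ_apply (SignedMeasure.integrable_rnDeriv _ _) hA]

lemma variation_withDensityᵥ_real_univ {μ : Measure (E N)} {F : E N → E N}
    (hF : Integrable F μ) : (μ.withDensityᵥ F).variation.real univ = ‖hF.toL1 F‖ := by
  rw [Measure.variation_withDensityᵥ hF, Integrable.norm_toL1_eq_lintegral_norm, Measure.real,
    withDensity_apply _ MeasurableSet.univ, Measure.restrict_univ]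
  simp only [← ofReal_norm]

lemma norm_integral_smul_le {D : VectorMeasure (E N) (E N)}
    [IsFiniteMeasure D.variation] {φ : E N → ℝ} {C : ℝ} (hφ : ∀ x, ‖φ x‖ ≤ C) :
    ‖∫ᵛ x, φ x ∂•D‖ ≤ C * D.variation.real univ := by
  calc ‖∫ᵛ x, φ x ∂•D‖ ≤ ‖ContinuousLinearMap.lsmul ℝ ℝ (E := E N)‖ * ∫ x, ‖φ x‖ ∂D.variation :=
        VectorMeasure.norm_integral_le_integral_norm
    _ ≤ 1 * ∫ x, ‖φ x‖ ∂D.variation := by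
        gcongr
        exact ContinuousLinearMap.opNorm_lsmul_le
    _ ≤ C * D.variation.real univ := by
        rw [one_mul, mul_comm, ← smul_eq_mul, ← integral_const]
        exact integral_mono_of_nonneg (.of_forall fun _ => norm_nonneg _) (integrable_const C)
          (.of_forall hφ)

/-- Each coordinate of the integral is an inner product with a fixed element of `L²(Ω)`. This lets
the defining identity of the gradient pass to limits. -/
lemma tendsto_integral_smul_gradient {v : ℕ → L2 Ω} {w : L2 Ω}
    (h : Tendsto v atTop (𝓝 w)) (φ : 𝓓(Ω, ℝ)) :
    Tendsto (fun n => ∫ x in (Ω : Set (E N)), v n x • ∇ φ x) atTop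
      (𝓝 (∫ x in (Ω : Set (E N)), w x • ∇ φ x)) := by
  have hc : Continuous (∇ φ) :=
    (InnerProductSpace.toDual ℝ (E N)).symm.continuous.comp (φ.contDiff.continuous_fderiv (by simp))
  have hs : HasCompactSupport (∇ φ) :=
    (φ.hasCompactSupport.fderiv ℝ).comp_left (g := (InnerProductSpace.toDual ℝ (E N)).symm)
      (map_zero _)
  have h2 (i : Fin N) : MemLp (fun x => ∇ φ x i) 2 (volOn Ω) :=
    (hc.memLp_of_hasCompactSupport hs).eval_piLp i
  have key (i : Fin N) (v : L2 Ω) :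
      (∫ x in (Ω : Set (E N)), v x • ∇ φ x) i = ⟪(h2 i).toLp, v⟫_ℝ := by
    rw [eval_integral_piLp fun i => (integrable_smul_gradient v φ).eval_piLp i, L2.inner_def]
    refine integral_congr_ae ?_
    filter_upwards [(h2 i).coeFn_toLp] with x hx
    rw [hx]
    rfl
  rw [(EuclideanSpace.equiv (Fin N) ℝ).toHomeomorph.isInducing.tendsto_nhds_iff, tendsto_pi_nhds]
  intro i
  change Tendsto (fun n => (∫ x in (Ω : Set (E N)), v n x • ∇ φ x) i) atTop
    (𝓝 ((∫ x in (Ω : Set (E N)), w x • ∇ φ x) i))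
  simp_rw [key]
  exact tendsto_const_nhds.inner h

/-! ### The normed space `BV(Ω) ∩ L²(Ω)`: separable subsets and completeness -/

namespace BVL2

lemma grad_sub (v w : BVL2 Ω) : grad (v - w) = grad v - grad w := by
  have h : grad (v + (-1 : ℝ) • w) = grad v + (-1 : ℝ) • grad w := by
    apply grad_eq
    rw [map_add, map_smul]
    exact (isGradMeasure_grad v).add ((isGradMeasure_grad w).smul _)
  have h' : (-1 : ℝ) • grad w = -grad w := by
    ext A
    simp
  rwa [neg_one_smul, h', ← sub_eq_add_neg, ← sub_eq_add_neg] at h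

lemma grad_add (v w : BVL2 Ω) : grad (v + w) = grad v + grad w := by
  apply grad_eq
  rw [map_add]
  exact (isGradMeasure_grad v).add (isGradMeasure_grad w)

lemma grad_smul (c : ℝ) (v : BVL2 Ω) : grad (c • v) = c • grad v := by
  apply grad_eq
  rw [map_smul]
  exact (isGradMeasure_grad v).smul c

lemma tv_eq_zero {v : BVL2 Ω} {A : Set (E N)} (h : tv v A = 0) : grad v A = 0 := by
  rw [← enorm_eq_zero, ← le_zero_iff, ← h]
  exact VectorMeasure.enorm_measure_le_variation _ _

lemma tv_univ (v : BVL2 Ω) : tv v univ = tv v Ω := by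
  refine le_antisymm ?_ (measure_mono (subset_univ _))
  have h : tv v (Ω : Set (E N))ᶜ = 0 := by
    rw [tv, VectorMeasure.variation_apply_eq_zero Ω.isOpen.measurableSet.compl]
    intro t ht htm
    rw [(isGradMeasure_grad v).concentrated t htm,
      (disjoint_left.2 fun x hx => ht hx : Disjoint t (Ω : Set (E N))).inter_eq, VectorMeasure.empty]
  rw [← union_compl_self (Ω : Set (E N))]
  exact (measure_union_le _ _).trans (by rw [h, add_zero])

lemma norm_eq (v : BVL2 Ω) : ‖v‖ = (tv v).real univ + ‖toL2 v‖ := by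
  rw [norm_def, Measure.real, Measure.real, tv_univ]

lemma norm_toL2_le (v : BVL2 Ω) : ‖toL2 v‖ ≤ ‖v‖ := by
  rw [norm_eq]
  exact le_add_of_nonneg_left measureReal_nonneg

lemma norm_grad_apply_le (v : BVL2 Ω) (A : Set (E N)) : ‖grad v A‖ ≤ ‖v‖ := by
  have h : ‖grad v A‖ ≤ (tv v).real A :=
    VectorMeasure.norm_measure_le_variation (measure_ne_top (tv v) A)
  rw [norm_eq]
  exact (h.trans (measureReal_mono (subset_univ _))).trans
    (le_add_of_nonneg_right (norm_nonneg _))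

/-- The inclusion of `BV(Ω) ∩ L²(Ω)` in `L²(Ω)` as a continuous map. -/
def toL2L (Ω : Opens (E N)) : BVL2 Ω →L[ℝ] L2 Ω :=
  toL2.mkContinuous 1 fun v => by simpa using norm_toL2_le v

@[simp] lemma toL2L_apply (v : BVL2 Ω) : toL2L Ω v = toL2 v := rfl

/-- If `F` and `G` are densities of `Dv` and `Dw`, the norm of `v - w` is
`‖F - G‖_{L¹} + ‖v - w‖_{L²}`. -/
lemma norm_sub_eq {μ : Measure (E N)} {v w : BVL2 Ω} {F G : E N → E N}
    (hF : Integrable F μ) (hG : Integrable G μ) (hv : μ.withDensityᵥ F = grad v)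
    (hw : μ.withDensityᵥ G = grad w) :
    ‖v - w‖ = ‖hF.toL1 F - hG.toL1 G‖ + ‖toL2 v - toL2 w‖ := by
  rw [norm_eq, map_sub, tv, grad_sub, ← hv, ← hw, ← withDensityᵥ_sub hF hG,
    variation_withDensityᵥ_real_univ (hF.sub hG), Integrable.toL1_sub F G hF hG]

/-- The elements whose gradient is absolutely continuous with respect to `μ` form a separable
set. -/
lemma isSeparable_grad_absolutelyContinuous (Ω : Opens (E N)) (μ : Measure (E N)) [SigmaFinite μ] :
    IsSeparable {v : BVL2 Ω | ∀ A, μ A = 0 → grad v A = 0} := by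
  set Y := {v : BVL2 Ω | ∀ A, μ A = 0 → grad v A = 0}
  have h (v : Y) : ∃ F : E N → E N, Integrable F μ ∧ μ.withDensityᵥ F = grad (v : BVL2 Ω) :=
    exists_withDensityᵥ_eq v.2
  choose F hF hFv using h
  let J : Y → (E N →₁[μ] E N) × L2 Ω := fun v => ((hF v).toL1 (F v), toL2 (v : BVL2 Ω))
  have hd (v w : Y) : dist v w = dist (J v).1 (J w).1 + dist (J v).2 (J w).2 := by
    rw [Subtype.dist_eq, dist_eq_norm, norm_sub_eq (hF v) (hF w) (hFv v) (hFv w), dist_eq_norm,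
      dist_eq_norm]
  -- The distance is exactly the sum of the two component distances, while the product carries their
  -- maximum; hence the constants 2 and 1.
  have hJ : AntilipschitzWith 2 J := by
    refine AntilipschitzWith.of_le_mul_dist fun v w => ?_
    rw [hd, Prod.dist_eq, NNReal.coe_ofNat, two_mul]
    exact add_le_add (le_max_left _ _) (le_max_right _ _)
  have hJc : Continuous J := by
    refine (LipschitzWith.of_dist_le_mul (K := 1) fun v w => ?_).continuous
    rw [hd, Prod.dist_eq, NNReal.coe_one, one_mul]
    exact max_le (le_add_of_nonneg_right dist_nonneg) (le_add_of_nonneg_left dist_nonneg)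
  have : Fact ((2 : ℝ≥0∞) ≠ ∞) := ⟨by simp⟩
  have : Fact ((1 : ℝ≥0∞) ≠ ∞) := ⟨by simp⟩
  have h2 := (hJ.isInducing hJc).isSeparable_preimage (IsSeparable.of_separableSpace univ)
  have := h2.image continuous_subtype_val
  simpa using this

/-- One finite measure dominates all gradients of a Cauchy sequence, so their densities are Cauchy
in `L¹` and the functions are Cauchy in `L²(Ω)`. The limit density defines the gradient of the limit
function. Completeness makes the Bochner integral available. -/
instance : CompleteSpace (BVL2 Ω) := by
  refine Metric.complete_of_cauchySeq_tendsto fun v hv => ?_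
  -- The sum may be infinite; `toFinite` replaces it by a finite measure that still dominates it.
  let μ : Measure (E N) := (Measure.sum fun n => tv (v n)).toFinite
  have hμ (n : ℕ) (A : Set (E N)) (hA : μ A = 0) : grad (v n) A = 0 := by
    have h1 : Measure.sum (fun n => tv (v n)) A = 0 := absolutelyContinuous_toFinite _ hA
    have h2 : tv (v n) A = 0 := le_antisymm ((Measure.le_sum _ n A).trans h1.le) zero_le
    exact tv_eq_zero h2
  choose F hF hFv using fun n => exists_withDensityᵥ_eq (hμ n)
  have hd (m n : ℕ) : dist (v m) (v n) =
      dist ((hF m).toL1 (F m)) ((hF n).toL1 (F n)) + dist (toL2 (v m)) (toL2 (v n)) := by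
    rw [dist_eq_norm, norm_sub_eq (hF m) (hF n) (hFv m) (hFv n), dist_eq_norm, dist_eq_norm]
  rw [Metric.cauchySeq_iff] at hv
  obtain ⟨G, hG⟩ : ∃ G, Tendsto (fun n => (hF n).toL1 (F n)) atTop (𝓝 G) := by
    refine cauchySeq_tendsto_of_complete (Metric.cauchySeq_iff.2 fun ε hε => ?_)
    obtain ⟨k, hk⟩ := hv ε hε
    exact ⟨k, fun m hm n hn =>
      ((le_add_of_nonneg_right dist_nonneg).trans (hd m n).ge).trans_lt (hk m hm n hn)⟩
  obtain ⟨w, hw⟩ : ∃ w, Tendsto (fun n => toL2 (v n)) atTop (𝓝 w) := by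
    refine cauchySeq_tendsto_of_complete (Metric.cauchySeq_iff.2 fun ε hε => ?_)
    obtain ⟨k, hk⟩ := hv ε hε
    exact ⟨k, fun m hm n hn =>
      ((le_add_of_nonneg_left dist_nonneg).trans (hd m n).ge).trans_lt (hk m hm n hn)⟩
  have hGi : Integrable G μ := L1.integrable_coeFn G
  have hGL : hGi.toL1 G = G := Integrable.toL1_coeFn G hGi
  set D := μ.withDensityᵥ G with hD
  have hlim : Tendsto (fun n => (D - grad (v n)).variation.real univ) atTop (𝓝 0) := by
    rw [tendsto_iff_dist_tendsto_zero] at hG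
    refine hG.congr fun n => ?_
    rw [hD, ← hFv n, ← withDensityᵥ_sub hGi (hF n),
      variation_withDensityᵥ_real_univ (hGi.sub (hF n)), Integrable.toL1_sub _ _ hGi, hGL, dist_comm,
      dist_eq_norm]
  have hfin : IsFiniteMeasure D.variation := by
    rw [hD, Measure.variation_withDensityᵥ hGi]
    exact ⟨by simpa using! hGi.2⟩
  have hfin' (n : ℕ) : IsFiniteMeasure (grad (v n)).variation := (isGradMeasure_grad (v n)).finite
  have hfin2 (n : ℕ) : IsFiniteMeasure (D - grad (v n)).variation :=
    isFiniteMeasure_of_le _ VectorMeasure.variation_sub_le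
  have hDw : IsGradMeasure Ω w D := by
    refine ⟨hfin, fun A hA => ?_, fun φ => ?_⟩
    · have h1 (B : Set (E N)) : Tendsto (fun n => grad (v n) B) atTop (𝓝 (D B)) := by
        rw [tendsto_iff_norm_sub_tendsto_zero]
        refine squeeze_zero (fun _ => norm_nonneg _) (fun n => ?_) hlim
        rw [norm_sub_rev, ← _root_.sub_apply]
        exact (VectorMeasure.norm_measure_le_variation (measure_ne_top _ _)).trans
          (measureReal_mono (subset_univ _))
      refine tendsto_nhds_unique (h1 A) ((h1 (A ∩ Ω)).congr fun n => ?_)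
      exact ((isGradMeasure_grad (v n)).concentrated A hA).symm
    · obtain ⟨C, hC⟩ := φ.continuous.bounded_above_of_compact_support φ.hasCompactSupport
      refine tendsto_nhds_unique (tendsto_integral_smul_gradient hw φ) ?_
      simp_rw [(isGradMeasure_grad _).integral_eq]
      refine Tendsto.neg ?_
      rw [tendsto_iff_norm_sub_tendsto_zero]
      refine squeeze_zero (fun _ => norm_nonneg _) (fun n => ?_)
        (by simpa using hlim.const_mul C)
      rw [norm_sub_rev, ← VectorMeasure.integral_sub_vectorMeasure (integrable_test hfin φ)
        (integrable_test (hfin' n) φ)]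
      exact norm_integral_smul_le hC
  let x : BVL2 Ω := ⟨w, D, hDw⟩
  have hx : grad x = D := grad_eq hDw
  refine ⟨x, ?_⟩
  rw [tendsto_iff_norm_sub_tendsto_zero]
  rw [tendsto_iff_norm_sub_tendsto_zero] at hw
  have := hlim.add hw
  rw [add_zero] at this
  refine this.congr fun n => ?_
  rw [norm_sub_rev (v n), norm_eq, tv, grad_sub, hx, map_sub, norm_sub_rev (toL2 (v n))]
  rfl

end BVL2

/-! ### The singular part of the gradient -/

namespace BVL2

/-- A `μ`-null set which carries the part of `Dv` that is singular with respect to `μ`. -/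
def singularSet (μ : Measure (E N)) (v : BVL2 Ω) : Set (E N) :=
  (Measure.mutuallySingular_singularPart (tv v) μ).nullSetᶜ

variable {μ : Measure (E N)}

lemma measurableSet_singularSet (v : BVL2 Ω) : MeasurableSet (singularSet μ v) :=
  (Measure.MutuallySingular.measurableSet_nullSet _).compl

lemma measure_singularSet (v : BVL2 Ω) : μ (singularSet μ v) = 0 :=
  Measure.MutuallySingular.measure_compl_nullSet _

/-- In the Lebesgue decomposition of `|Dv|`, the singular part lives on `singularSet μ v` and the
other part does not charge `B`. -/
lemma tv_diff_singularSet [SigmaFinite μ] (v : BVL2 Ω) {B : Set (E N)} (hB : μ B = 0) :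
    tv v (B \ singularSet μ v) = 0 := by
  rw [Measure.haveLebesgueDecomposition_add (tv v) μ, Measure.add_apply, add_eq_zero]
  constructor
  · refine measure_mono_null (fun x hx => not_notMem.1 hx.2)
      (Measure.mutuallySingular_singularPart (tv v) μ).measure_nullSet
  · exact withDensity_absolutelyContinuous _ _ (measure_mono_null sdiff_subset hB)

/-- The singular part can be read off on any larger `μ`-null set. Several functions can thus share
one set, on which `D` is visibly linear. -/
lemma grad_inter_eq [SigmaFinite μ] (v : BVL2 Ω) {A B : Set (E N)} (hA : MeasurableSet A)
    (hB : MeasurableSet B) (hAμ : μ A = 0) (h : singularSet μ v ⊆ A) :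
    grad v (A ∩ B) = grad v (singularSet μ v ∩ B) := by
  have hm := measurableSet_singularSet (μ := μ) v
  have h1 : grad v ((A ∩ B) \ (singularSet μ v ∩ B)) = 0 := by
    refine tv_eq_zero (measure_mono_null ?_ (tv_diff_singularSet v hAμ))
    exact fun x hx => ⟨hx.1.1, fun h' => hx.2 ⟨h', hx.1.2⟩⟩
  rw [← VectorMeasure.of_add_of_sdiff (hm.inter hB) (hA.inter hB) (inter_subset_inter_left _ h), h1,
    add_zero]

/-- The value on `B` of the part of `Dv` that is singular with respect to `μ`. -/
def singularGrad (Ω : Opens (E N)) (μ : Measure (E N)) [SigmaFinite μ] {B : Set (E N)}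
    (hB : MeasurableSet B) : BVL2 Ω →L[ℝ] E N :=
  LinearMap.mkContinuous
    { toFun := fun v => grad v (singularSet μ v ∩ B)
      map_add' := fun v w => by
        set A := singularSet μ v ∪ singularSet μ w ∪ singularSet μ (v + w)
        have hA : MeasurableSet A := ((measurableSet_singularSet _).union
          (measurableSet_singularSet _)).union (measurableSet_singularSet _)
        have hA0 : μ A = 0 := measure_union_null
          (measure_union_null (measure_singularSet _) (measure_singularSet _))
          (measure_singularSet _)
        rw [← grad_inter_eq (v + w) hA hB hA0 subset_union_right,
          ← grad_inter_eq v hA hB hA0 (subset_union_left.trans subset_union_left),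
          ← grad_inter_eq w hA hB hA0 (subset_union_right.trans subset_union_left), grad_add]
        rfl
      map_smul' := fun c v => by
        set A := singularSet μ v ∪ singularSet μ (c • v)
        have hA : MeasurableSet A :=
          (measurableSet_singularSet _).union (measurableSet_singularSet _)
        have hA0 : μ A = 0 := measure_union_null (measure_singularSet _) (measure_singularSet _)
        rw [← grad_inter_eq (c • v) hA hB hA0 subset_union_right,
          ← grad_inter_eq v hA hB hA0 subset_union_left, grad_smul]
        rfl }
    1 fun v => by simpa using norm_grad_apply_le v _

lemma singularGrad_eq_zero [SigmaFinite μ] {v : BVL2 Ω} (hv : tv v ≪ μ) {B : Set (E N)}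
    (hB : MeasurableSet B) : singularGrad Ω μ hB v = 0 :=
  tv_eq_zero (measure_mono_null inter_subset_left (hv (measure_singularSet v)))

/-- Restricted to the singular set, `Dv` vanishes on a generating π-system, hence everywhere; off
that set, `|Dv|` does not charge `μ`-null sets. -/
lemma grad_absolutelyContinuous_of_singularGrad [SigmaFinite μ] {v : BVL2 Ω}
    {C : Set (Set (E N))} (hC : ∀ B ∈ C, MeasurableSet B) (hp : IsPiSystem C)
    (hg : borel (E N) = MeasurableSpace.generateFrom C) (hu : univ ∈ C)
    (h : ∀ B (hB : B ∈ C), singularGrad Ω μ (hC B hB) v = 0) (A : Set (E N)) (hA : μ A = 0) :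
    grad v A = 0 := by
  by_cases hm : MeasurableSet A
  swap
  · exact (grad v).not_measurable hm
  set S := singularSet μ v
  have hS : MeasurableSet S := measurableSet_singularSet v
  have hC0 : ∀ B ∈ C, (grad v).restrict S B = (0 : VectorMeasure (E N) (E N)) B := fun B hB => by
    rw [VectorMeasure.restrict_apply _ hS (hC B hB), inter_comm]
    exact h B hB
  have h0 : (grad v).restrict S = 0 := VectorMeasure.ext_of_generateFrom C hC0
    (by rw [← hg]; exact BorelSpace.measurable_eq) hp (hC0 _ hu)
  have h1 : grad v (A ∩ S) = 0 := by
    rw [← VectorMeasure.restrict_apply _ hS hm, h0]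
    rfl
  have h2 : grad v (A \ (A ∩ S)) = 0 := by
    rw [sdiff_self_inter]
    exact tv_eq_zero (tv_diff_singularSet v hA)
  rw [← VectorMeasure.of_add_of_sdiff (hm.inter hS) hm inter_subset_left, h1, h2, add_zero]

end BVL2

/-! ### Strong measurability -/

lemma ae_eq_zero_of_forall_setIntegral_Iio_rat {T : ℝ} {f : ℝ → ℝ} (hf : IntegrableOn f (Ioo 0 T))
    (h : ∀ q : ℚ, ∫ t in Ioo 0 T ∩ Iio (q : ℝ), f t = 0) :
    f =ᵐ[volume.restrict (Ioo 0 T)] 0 := by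
  have h1 (q : ℚ) : ∫ t in Iio (q : ℝ), f t ∂volume.restrict (Ioo 0 T) = 0 := by
    rw [Measure.restrict_restrict measurableSet_Iio, inter_comm, h]
  refine Integrable.ae_eq_of_withDensityᵥ_eq hf (integrable_zero _ _ _) ?_
  rw [withDensityᵥ_zero]
  refine VectorMeasure.ext_of_generateFrom (⋃ a : ℚ, {Iio (a : ℝ)}) ?_
    (by rw [← Real.borel_eq_generateFrom_Iio_rat]; exact BorelSpace.measurable_eq)
    Real.isPiSystem_Iio_rat ?_
  · intro s hs
    obtain ⟨q, rfl⟩ := by simpa using hs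
    rw [withDensityᵥ_apply hf measurableSet_Iio, h1]
    rfl
  -- The total mass is covered by a rational `q > T`.
  · obtain ⟨q, hq⟩ := exists_rat_gt T
    have h2 := h q
    rw [inter_eq_self_of_subset_left fun t ht => ht.2.trans hq] at h2
    rw [withDensityᵥ_apply hf MeasurableSet.univ, Measure.restrict_univ, h2]
    rfl

/-- A Pettis integrable map to `BV(Ω) ∩ L²(Ω)` has essentially separable range. -/
lemma MemL1.exists_isSeparable {T : ℝ} {U : ℝ → BVL2 Ω} (hU : MemL1 T U) :
    ∃ Y : Set (BVL2 Ω), IsSeparable Y ∧ ∀ᵐ t ∂volume.restrict (Ioo 0 T), U t ∈ Y := by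
  choose v hv using fun q : ℚ =>
    hU.2 (Ioo 0 T ∩ Iio (q : ℝ)) (measurableSet_Ioo.inter measurableSet_Iio) inter_subset_left
  let μ : Measure (E N) := (Measure.sum fun q => tv (v q)).toFinite
  have hμ (q : ℚ) : tv (v q) ≪ μ :=
    (Measure.absolutelyContinuous_of_le (Measure.le_sum _ q)).trans (absolutelyContinuous_toFinite _)
  refine ⟨_, isSeparable_grad_absolutelyContinuous Ω μ, ?_⟩
  -- Countability of `C` allows a single exceptional null set of times for all its members.
  let C := generateSetAlgebra (MeasurableSpace.countableGeneratingSet (E N))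
  have hCc : C.Countable :=
    countable_generateSetAlgebra MeasurableSpace.countable_countableGeneratingSet
  have hCa : IsSetAlgebra C := isSetAlgebra_generateSetAlgebra
  have hg : MeasurableSpace.generateFrom C = borel (E N) := by
    rw [generateFrom_generateSetAlgebra_eq, MeasurableSpace.generateFrom_countableGeneratingSet]
    exact BorelSpace.measurable_eq
  have hCm : ∀ B ∈ C, MeasurableSet B := fun B hB => by
    rw [BorelSpace.measurable_eq (α := E N), ← hg]
    exact MeasurableSpace.measurableSet_generateFrom hB
  have hCp : IsPiSystem C := fun A hA B hB _ => hCa.inter_mem hA hB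
  have key : ∀ B ∈ C, ∀ᵐ t ∂volume.restrict (Ioo 0 T), ∀ hB : MeasurableSet B,
      singularGrad Ω μ hB (U t) = 0 := by
    intro B hBC
    have hB := hCm B hBC
    have (i : Fin N) : ∀ᵐ t ∂volume.restrict (Ioo 0 T), singularGrad Ω μ hB (U t) i = 0 := by
      let l : StrongDual ℝ (BVL2 Ω) := (EuclideanSpace.proj i).comp (singularGrad Ω μ hB)
      obtain ⟨w, hw⟩ := hU.2 (Ioo 0 T) measurableSet_Ioo subset_rfl
      refine ae_eq_zero_of_forall_setIntegral_Iio_rat (f := fun t => l (U t)) (hw l).1 fun q => ?_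
      rw [(hv q l).2]
      change singularGrad Ω μ hB (v q) i = 0
      rw [singularGrad_eq_zero (hμ q) hB]
      rfl
    filter_upwards [ae_all_iff.2 this] with t ht _
    ext i
    exact ht i
  filter_upwards [(ae_ball_iff hCc).2 key] with t ht
  exact grad_absolutelyContinuous_of_singularGrad hCm hCp hg.symm hCa.univ_mem
    fun B hB => ht B hB _

/-- Pettis measurability theorem. -/
lemma aestronglyMeasurable_of_forall_dual {α X : Type*} [MeasurableSpace α] {μ : Measure α}
    [NormedAddCommGroup X] [NormedSpace ℝ X] {f : α → X} {Y : Set X} (hY : IsSeparable Y)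
    (hfY : ∀ᵐ a ∂μ, f a ∈ Y) (hf : ∀ l : StrongDual ℝ X, AEMeasurable (fun a => l (f a)) μ) :
    AEStronglyMeasurable f μ := by
  borelize X
  let Z : Submodule ℝ X := Submodule.span ℝ Y
  have hZ : IsSeparable (Z : Set X) := hY.span (R := ℝ)
  obtain ⟨c, hcZ, hcc, hc⟩ := hZ.exists_countable_dense_subset
  -- Norming functionals at a countable dense subset of the span recover the norm there as a
  -- countable supremum, so distances to `f` are measurable.
  choose l hl1 hl using fun x : X => exists_dual_vector'' ℝ x
  have hle (x z : X) : ‖l x z‖ ≤ ‖z‖ := by simpa using (l x).le_of_opNorm_le (hl1 x) z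
  have hnorm : ∀ z ∈ Z, ⨆ x ∈ c, ‖l x z‖ₑ = ‖z‖ₑ := by
    intro z hz
    refine le_antisymm (iSup₂_le fun x hx => enorm_le_iff_norm_le.2 (hle x z)) ?_
    refine ENNReal.le_of_forall_pos_le_add fun ε hε _ => ?_
    obtain ⟨x, hx, hxz⟩ := Metric.mem_closure_iff.1 (hc hz) (ε / 2) (half_pos (by exact_mod_cast hε))
    have h1 : ‖z‖ ≤ ‖l x z‖ + ε := by
      rw [dist_eq_norm] at hxz
      have h2 : ‖z‖ ≤ ‖x‖ + ‖z - x‖ := norm_le_insert' z x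
      have h3 : ‖x‖ ≤ ‖l x z‖ + ‖l x (z - x)‖ := by
        have h4 : ‖x‖ = l x z - l x (z - x) := by rw [map_sub, sub_sub_cancel]; exact (hl x).symm
        rw [h4]
        exact (Real.le_norm_self _).trans (norm_sub_le _ _)
      linarith [hle x (z - x)]
    have h5 : ‖z‖ₑ ≤ ‖l x z‖ₑ + ε := by
      rw [enorm_eq_nnnorm, enorm_eq_nnnorm]
      exact_mod_cast h1
    exact h5.trans (add_le_add_left (le_iSup₂ (f := fun x _ => ‖l x z‖ₑ) x hx) _)
  have hdist : ∀ z ∈ Z, AEMeasurable (fun a => ‖f a - z‖ₑ) μ := by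
    intro z hz
    have h1 : AEMeasurable (fun a => ⨆ x ∈ c, ‖l x (f a - z)‖ₑ) μ := by
      refine AEMeasurable.biSup _ hcc fun x _ => ?_
      simp_rw [map_sub]
      exact ((hf (l x)).sub_const _).enorm
    refine h1.congr ?_
    filter_upwards [hfY] with a ha
    exact hnorm _ (Z.sub_mem (Submodule.subset_span ha) hz)
  have hnull : NullMeasurable f μ := by
    refine measurable_of_isOpen (γ := X) (δ := NullMeasurableSpace α μ) fun O hO => ?_
    let S : Set α := ⋃ x ∈ c, ⋃ q ∈ {q : ℚ | Metric.ball x q ⊆ O},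
      {a | ‖f a - x‖ₑ < ENNReal.ofReal q}
    have hS : NullMeasurableSet S μ := by
      refine NullMeasurableSet.biUnion hcc fun x hx =>
        NullMeasurableSet.biUnion (to_countable _) fun q _ => ?_
      exact nullMeasurableSet_lt (hdist x (hcZ hx)) aemeasurable_const
    refine hS.congr ?_
    filter_upwards [hfY] with a ha
    refine propext ⟨fun h => ?_, fun h => ?_⟩
    · obtain ⟨x, hx, q, hq, haq⟩ : ∃ x ∈ c, ∃ q : ℚ, Metric.ball x q ⊆ O ∧
        ‖f a - x‖ₑ < ENNReal.ofReal q := by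
        have h' : a ∈ S := h
        simpa [S] using h'
      refine hq ?_
      rw [mem_ball_iff_norm]
      rw [← ofReal_norm] at haq
      exact (ENNReal.ofReal_lt_ofReal_iff_of_nonneg (norm_nonneg _)).1 haq
    · obtain ⟨r, hr, hrO⟩ := Metric.isOpen_iff.1 hO (f a) h
      -- With `q < r / 2` and `x` within `q` of `f a`, the ball of radius `q` about `x` stays within
      -- `r` of `f a`.
      obtain ⟨q, hq0, hq⟩ := exists_rat_btwn (half_pos hr)
      obtain ⟨x, hx, hxf⟩ := Metric.mem_closure_iff.1 (hc (Submodule.subset_span ha)) q hq0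
      refine mem_biUnion hx (mem_biUnion (x := q) (fun y hy => hrO ?_) ?_)
      · rw [Metric.mem_ball] at hy ⊢
        rw [dist_comm] at hxf
        linarith [dist_triangle y x (f a)]
      · rw [dist_eq_norm] at hxf
        change ‖f a - x‖ₑ < ENNReal.ofReal q
        rw [← ofReal_norm]
        exact (ENNReal.ofReal_lt_ofReal_iff hq0).2 hxf
  have : SecondCountableTopology Y := hY.secondCountableTopology
  exact aestronglyMeasurable_iff_aemeasurable_separable.2
    ⟨hnull.aemeasurable_of_aerange hfY, Y, hY, hfY⟩

/-- A Pettis integrable map to `BV(Ω) ∩ L²(Ω)` with integrable norm is Bochner integrable. -/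
lemma MemL1.integrableOn {T : ℝ} {U : ℝ → BVL2 Ω} (hU : MemL1 T U) : IntegrableOn U (Ioo 0 T) := by
  obtain ⟨Y, hY, hUY⟩ := hU.exists_isSeparable
  exact ⟨aestronglyMeasurable_of_forall_dual hY hUY hU.1.1, hU.1.2⟩

/-! ### Backward averages -/

section BackwardMean

variable {X : Type*} [NormedAddCommGroup X] [NormedSpace ℝ X]

/-- The average `(1/ε) ∫_{t-ε}^t V(s) ds` (a Bochner integral). -/
def backwardMean (ε : ℝ) (V : ℝ → X) (t : ℝ) : X := ε⁻¹ • ∫ s in Ioo (t - ε) t, V s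

lemma continuous_backwardMean {V : ℝ → X} (hV : Integrable V) {ε : ℝ} (hε : 0 < ε) :
    Continuous (backwardMean ε V) := by
  have h (a b : ℝ) : IntervalIntegrable V volume a b := hV.intervalIntegrable
  have hc : Continuous fun t => ∫ s in (0 : ℝ)..t, V s := intervalIntegral.continuous_primitive h 0
  have heq : backwardMean ε V =
      fun t => ε⁻¹ • ((∫ s in (0 : ℝ)..t, V s) - ∫ s in (0 : ℝ)..(t - ε), V s) := by
    ext t
    rw [backwardMean, intervalIntegral.integral_interval_sub_left (h _ _) (h _ _),
      intervalIntegral.integral_of_le (by linarith), integral_Ioc_eq_integral_Ioo]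
  rw [heq]
  exact (hc.sub (hc.comp (continuous_id.sub continuous_const))).const_smul _

lemma norm_backwardMean_le {V : ℝ → X} (hV : Integrable V) {ε : ℝ} (hε : 0 < ε) (t : ℝ) :
    ‖backwardMean ε V t‖ ≤ ε⁻¹ * ∫ s, ‖V s‖ := by
  rw [backwardMean, norm_smul, Real.norm_of_nonneg (inv_nonneg.2 hε.le)]
  gcongr
  exact (norm_integral_le_integral_norm _).trans
    (setIntegral_le_integral hV.norm (.of_forall fun _ => norm_nonneg _))

lemma backwardMean_sub {V W : ℝ → X} (hV : Integrable V) (hW : Integrable W) (ε t : ℝ) :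
    backwardMean ε (V - W) t = backwardMean ε V t - backwardMean ε W t := by
  simp only [backwardMean, Pi.sub_apply]
  rw [integral_sub hV.integrableOn hW.integrableOn, smul_sub]

/-- By Tonelli: a point `s` lies in the window `(t - ε, t)` exactly for `t ∈ (s, s + ε)`, and the
length `ε` cancels the factor `ε⁻¹`. -/
lemma lintegral_enorm_backwardMean_le {V : ℝ → X} (hV : AEStronglyMeasurable V) {ε : ℝ}
    (hε : 0 < ε) : ∫⁻ t, ‖backwardMean ε V t‖ₑ ≤ ∫⁻ t, ‖V t‖ₑ := by
  have hS : MeasurableSet {p : ℝ × ℝ | p.2 ∈ Ioo (p.1 - ε) p.1} :=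
    (measurableSet_lt (measurable_fst.sub_const ε) measurable_snd).inter
      (measurableSet_lt measurable_snd measurable_fst)
  have hm : AEMeasurable (Function.uncurry fun t s => (Ioo (t - ε) t).indicator (fun s => ‖V s‖ₑ) s)
      (volume.prod volume) := by
    have : AEMeasurable (fun p : ℝ × ℝ => ‖V p.2‖ₑ) (volume.prod volume) := hV.enorm.comp_snd
    exact this.indicator hS
  calc ∫⁻ t, ‖backwardMean ε V t‖ₑ
      ≤ ∫⁻ t, ENNReal.ofReal ε⁻¹ * ∫⁻ s, (Ioo (t - ε) t).indicator (fun s => ‖V s‖ₑ) s := by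
        refine lintegral_mono fun t => ?_
        rw [backwardMean, enorm_smul, Real.enorm_of_nonneg (inv_nonneg.2 hε.le),
          lintegral_indicator measurableSet_Ioo]
        gcongr
        exact enorm_integral_le_lintegral_enorm _
    _ = ENNReal.ofReal ε⁻¹ * ∫⁻ s, ∫⁻ t, (Ioo (t - ε) t).indicator (fun s => ‖V s‖ₑ) s := by
        rw [lintegral_const_mul' _ _ ENNReal.ofReal_ne_top, lintegral_lintegral_swap hm]
    _ = ENNReal.ofReal ε⁻¹ * ∫⁻ s, ENNReal.ofReal ε * ‖V s‖ₑ := by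
        congr 1
        refine lintegral_congr fun s => ?_
        have : (fun t => (Ioo (t - ε) t).indicator (fun s => ‖V s‖ₑ) s) =
            (Ioo s (s + ε)).indicator fun _ => ‖V s‖ₑ := by
          ext t
          simp only [indicator, mem_Ioo]
          congr 1
          exact propext ⟨fun h => ⟨h.2, by linarith [h.1]⟩, fun h => ⟨by linarith [h.2], h.1⟩⟩
        rw [this, lintegral_indicator_const measurableSet_Ioo, Real.volume_Ioo,
          add_sub_cancel_left, mul_comm]
    _ = ∫⁻ t, ‖V t‖ₑ := by
        rw [lintegral_const_mul' _ _ ENNReal.ofReal_ne_top, ← mul_assoc,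
          ← ENNReal.ofReal_mul (inv_nonneg.2 hε.le), inv_mul_cancel₀ hε.ne', ENNReal.ofReal_one,
          one_mul]

lemma eventually_norm_backwardMean_sub_le [CompleteSpace X] {W : ℝ → X} (hW : UniformContinuous W)
    {δ : ℝ} (hδ : 0 < δ) : ∀ᶠ ε in 𝓝[>] 0, ∀ t, ‖backwardMean ε W t - W t‖ ≤ δ := by
  obtain ⟨r, hr, h⟩ := Metric.uniformContinuous_iff.1 hW δ hδ
  filter_upwards [Ioo_mem_nhdsGT hr] with ε hε t
  have hvol : volume.real (Ioo (t - ε) t) = ε := by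
    rw [Real.volume_real_Ioo_of_le (by linarith [hε.1]), sub_sub_cancel]
  have hWi : IntegrableOn W (Ioo (t - ε) t) :=
    (hW.continuous.integrableOn_Icc (a := t - ε) (b := t)).mono_set Ioo_subset_Icc_self
  have h1 : backwardMean ε W t - W t = ε⁻¹ • ∫ s in Ioo (t - ε) t, (W s - W t) := by
    rw [integral_sub hWi (integrable_const _), setIntegral_const, hvol, smul_sub,
      inv_smul_smul₀ hε.1.ne', backwardMean]
  rw [h1, norm_smul, Real.norm_of_nonneg (inv_nonneg.2 hε.1.le)]
  have h2 : ‖∫ s in Ioo (t - ε) t, (W s - W t)‖ ≤ δ * volume.real (Ioo (t - ε) t) := by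
    refine norm_setIntegral_le_of_norm_le_const (by simp) fun s hs => ?_
    rw [← dist_eq_norm]
    refine (h ?_).le
    rw [Real.dist_eq, abs_lt]
    constructor <;> linarith [hs.1, hs.2, hε.2]
  rw [hvol] at h2
  calc ε⁻¹ * ‖∫ s in Ioo (t - ε) t, (W s - W t)‖ ≤ ε⁻¹ * (δ * ε) := by
        gcongr
        exact inv_nonneg.2 hε.1.le
    _ = δ := by
        field_simp [hε.1.ne']

/-- Backward averages converge in `L¹` on bounded intervals. -/
lemma tendsto_lintegral_enorm_backwardMean_sub [CompleteSpace X] {V : ℝ → X} (hV : Integrable V)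
    (a b : ℝ) : Tendsto (fun ε => ∫⁻ t in Ioo a b, ‖backwardMean ε V t - V t‖ₑ) (𝓝[>] 0) (𝓝 0) := by
  refine ENNReal.tendsto_nhds_zero.2 fun κ hκ => ?_
  obtain ⟨κ', hκ', hκ'κ⟩ : ∃ κ' : ℝ≥0∞, 0 < κ' ∧ κ' + κ' + κ' ≤ κ := by
    refine ⟨κ / 3, ENNReal.div_pos hκ.ne' (by simp), ?_⟩
    rw [ENNReal.add_thirds]
  -- Averaging contracts `L¹`, so it suffices to treat a continuous, compactly supported
  -- approximation, for which convergence is uniform.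
  obtain ⟨W, hWs, hVW, hWc, hW⟩ := hV.exists_hasCompactSupport_lintegral_sub_le hκ'.ne'
  obtain ⟨δ, hδ, hδκ⟩ : ∃ δ : ℝ, 0 < δ ∧ ENNReal.ofReal δ * volume (Ioo a b) ≤ κ' := by
    have : Tendsto (fun δ : ℝ => ENNReal.ofReal δ * volume (Ioo a b)) (𝓝[>] 0) (𝓝 0) := by
      have h1 : Tendsto (fun δ : ℝ => ENNReal.ofReal δ) (𝓝[>] 0) (𝓝 0) := by
        simpa using (ENNReal.continuous_ofReal.tendsto 0).mono_left nhdsWithin_le_nhds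
      simpa using ENNReal.Tendsto.mul_const h1 (b := volume (Ioo a b)) (Or.inr (by simp))
    obtain ⟨δ, h1, h2⟩ :=
      (((ENNReal.tendsto_nhds_zero.1 this) κ' hκ').and self_mem_nhdsWithin).exists
    exact ⟨δ, h2, h1⟩
  filter_upwards [eventually_norm_backwardMean_sub_le
    (hWs.uniformContinuous_of_continuous hWc) hδ, self_mem_nhdsWithin] with ε hε hε0
  have hsub : Integrable (V - W) := hV.sub hW
  have hsub' : AEMeasurable (fun t => ‖V t - W t‖ₑ) (volume.restrict (Ioo a b)) :=
    hsub.1.enorm.restrict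
  calc ∫⁻ t in Ioo a b, ‖backwardMean ε V t - V t‖ₑ
      ≤ ∫⁻ t in Ioo a b, (‖backwardMean ε (V - W) t‖ₑ + ENNReal.ofReal δ + ‖V t - W t‖ₑ) := by
        refine lintegral_mono fun t => ?_
        have h1 : backwardMean ε V t - V t =
            backwardMean ε (V - W) t + (backwardMean ε W t - W t) - (V t - W t) := by
          rw [backwardMean_sub hV hW]
          abel
        rw [h1]
        refine (enorm_sub_le).trans ?_
        gcongr
        refine (enorm_add_le _ _).trans ?_
        gcongr
        rw [← ofReal_norm]
        exact ENNReal.ofReal_le_ofReal (hε t)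
    _ ≤ κ' + κ' + κ' := by
        rw [lintegral_add_right' _ hsub',
          lintegral_add_right _ measurable_const, setLIntegral_const]
        gcongr
        · exact (setLIntegral_le_lintegral _ _).trans
            ((lintegral_enorm_backwardMean_le hsub.1 hε0).trans hVW)
        · exact (setLIntegral_le_lintegral _ _).trans hVW
    _ ≤ κ := hκ'κ

end BackwardMean

/-! ### Duality pairings -/

/-- Clear for simple `Ψ`; the general case follows from pointwise approximation and continuity of
each `ζ a`. -/
lemma aemeasurable_dual_apply {α X : Type*} [MeasurableSpace α] {μ : Measure α}
    [NormedAddCommGroup X] [NormedSpace ℝ X] {ζ : α → StrongDual ℝ X} {Ψ : α → X}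
    (hζ : ∀ v : X, AEMeasurable (fun a => ζ a v) μ) (hΨ : AEStronglyMeasurable Ψ μ) :
    AEMeasurable (fun a => ζ a (Ψ a)) μ := by
  obtain ⟨Φ, hΦ, hΨΦ⟩ := hΨ
  have hs (s : SimpleFunc α X) : AEMeasurable (fun a => ζ a (s a)) μ := by
    have h1 : (fun a => ζ a (s a)) =
        fun a => ∑ y ∈ s.range, (s ⁻¹' {y}).indicator (fun b => ζ b y) a := by
      ext a
      rw [Finset.sum_eq_single (s a)]
      · simp
      · intro y _ hy
        exact indicator_of_notMem (fun h : s a = y => hy h.symm) _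
      · exact fun h => absurd (s.mem_range_self a) h
    rw [h1]
    exact Finset.aemeasurable_fun_sum _ fun y _ => (hζ y).indicator (s.measurableSet_fiber y)
  have h2 : AEMeasurable (fun a => ζ a (Φ a)) μ := by
    refine aemeasurable_of_tendsto_metrizable_ae' (fun n => hs (hΦ.approx n)) (.of_forall fun a => ?_)
    exact ((ζ a).continuous.tendsto _).comp (hΦ.tendsto_approx a)
  refine h2.congr ?_
  filter_upwards [hΨΦ] with a ha
  rw [ha]

lemma integral_mul_eq_inner (g w : L2 Ω) :
    ∫ x in (Ω : Set (E N)), g x * w x = ⟪g, w⟫_ℝ := by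
  rw [L2.inner_def]
  refine integral_congr_ae (.of_forall fun x => ?_)
  simp [mul_comm]

lemma toL2_toBV {w : L2 Ω} (hw : w ∈ bvSubmodule Ω) : toL2 (toBV Ω w) = w := by
  have h : ∃ v : BVL2 Ω, toL2 v =ᵐ[volOn Ω] w := ⟨⟨w, hw⟩, .rfl⟩
  rw [toBV, dif_pos h]
  exact Lp.ext h.choose_spec

/-! ### Pettis integrals as Bochner integrals -/

section Pettis

variable {X : Type*} [NormedAddCommGroup X] [NormedSpace ℝ X]

lemma HasPettisIntegral.pettisIntegral_eq {U : ℝ → X} {S : Set ℝ} {v : X}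
    (h : HasPettisIntegral U S v) : pettisIntegral U S = v := by
  have hex : ∃ w, HasPettisIntegral U S w := ⟨v, h⟩
  rw [pettisIntegral, dif_pos hex]
  exact (SeparatingDual.eq_iff_forall_dual_eq (R := ℝ)).2 fun l =>
    (hex.choose_spec l).2.symm.trans (h l).2

lemma hasPettisIntegral_integral [CompleteSpace X] {U : ℝ → X} {S : Set ℝ}
    (h : IntegrableOn U S) : HasPettisIntegral U S (∫ t in S, U t) :=
  fun l => ⟨l.integrable_comp h, l.integral_comp_comm h⟩

end Pettis

/-- An element of `L¹(0,T;BV(Ω) ∩ L²(Ω))* + L¹(0,T;L²(Ω))` can be paired with every integrable map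
that is bounded in `L²(Ω)`. -/
lemma MemDualL1AddL1.integrableOn_apply {T : ℝ} {ξ : ℝ → StrongDual ℝ (BVL2 Ω)}
    (hξ : MemDualL1AddL1 Ω T ξ) {Φ : ℝ → BVL2 Ω} (hΦ : IntegrableOn Φ (Ioo 0 T)) {C : ℝ}
    (hC : ∀ᵐ t ∂volume.restrict (Ioo 0 T), ‖toL2 (Φ t)‖ ≤ C) :
    IntegrableOn (fun t => ξ t (Φ t)) (Ioo 0 T) := by
  obtain ⟨ζ, g, ⟨hζm, K, hK⟩, hg, h⟩ := hξ
  have h1 : IntegrableOn (fun t => ζ t (Φ t)) (Ioo 0 T) := by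
    refine Integrable.mono' (hΦ.norm.const_mul K)
      (aemeasurable_dual_apply hζm hΦ.1).aestronglyMeasurable ?_
    filter_upwards [hK] with t ht
    exact (ζ t).le_of_opNorm_le ht _
  have h2 : IntegrableOn (fun t => ⟪g t, toL2 (Φ t)⟫_ℝ) (Ioo 0 T) := by
    refine Integrable.mono' (hg.norm.mul_const C)
      (hg.1.inner ((toL2L Ω).continuous.comp_aestronglyMeasurable hΦ.1)) ?_
    filter_upwards [hC] with t ht
    exact (norm_inner_le_norm _ _).trans (by gcongr)
  refine (h1.add h2).congr ?_
  filter_upwards [h] with t ht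
  rw [ht, integral_mul_eq_inner]
  rfl

/-- The pairing with `ξ` is continuous under convergence in `L¹(0,T;BV(Ω) ∩ L²(Ω))` together with
uniform convergence in `L²(Ω)`. -/
lemma MemDualL1AddL1.tendsto_integral_apply {T : ℝ} {ξ : ℝ → StrongDual ℝ (BVL2 Ω)}
    (hξ : MemDualL1AddL1 Ω T ξ) {ι : Type*} {l : Filter ι} {Φ : ι → ℝ → BVL2 Ω} {V : ℝ → BVL2 Ω}
    (hΦ : ∀ᶠ i in l, IntegrableOn (fun t => ξ t (Φ i t)) (Ioo 0 T))
    (hV : IntegrableOn (fun t => ξ t (V t)) (Ioo 0 T))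
    (h1 : Tendsto (fun i => ∫⁻ t in Ioo 0 T, ‖Φ i t - V t‖ₑ) l (𝓝 0))
    (h2 : ∀ δ > 0, ∀ᶠ i in l, ∀ᵐ t ∂volume.restrict (Ioo 0 T), ‖toL2 (Φ i t - V t)‖ ≤ δ) :
    Tendsto (fun i => ∫ t in Ioo 0 T, ξ t (Φ i t)) l (𝓝 (∫ t in Ioo 0 T, ξ t (V t))) := by
  obtain ⟨ζ, g, ⟨-, K, hK⟩, hg, h⟩ := hξ
  refine tendsto_integral_of_L1 _ hV.1 hΦ ?_
  have h3 : Tendsto (fun i => ENNReal.ofReal K * ∫⁻ t in Ioo 0 T, ‖Φ i t - V t‖ₑ) l (𝓝 0) := by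
    simpa using ENNReal.Tendsto.const_mul h1 (a := ENNReal.ofReal K) (Or.inr ENNReal.ofReal_ne_top)
  have hg' : ∫⁻ t in Ioo 0 T, ‖g t‖ₑ ≠ ∞ := hg.2.ne
  refine ENNReal.tendsto_nhds_zero.2 fun κ hκ => ?_
  have hκ2 : 0 < κ / 2 := ENNReal.half_pos hκ.ne'
  -- Half of the error is allotted to `g`, half to `ζ`.
  obtain ⟨δ, hδ, hδκ⟩ : ∃ δ : ℝ, 0 < δ ∧ (∫⁻ t in Ioo 0 T, ‖g t‖ₑ) * ENNReal.ofReal δ ≤ κ / 2 := by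
    have h4 : Tendsto (fun δ : ℝ => ENNReal.ofReal δ) (𝓝[>] 0) (𝓝 0) := by
      simpa using (ENNReal.continuous_ofReal.tendsto 0).mono_left nhdsWithin_le_nhds
    have h5 := ENNReal.Tendsto.const_mul h4 (Or.inr hg')
    rw [mul_zero] at h5
    obtain ⟨δ, h6, h7⟩ :=
      (((ENNReal.tendsto_nhds_zero.1 h5) _ hκ2).and self_mem_nhdsWithin).exists
    exact ⟨δ, h7, h6⟩
  filter_upwards [h2 δ hδ, ENNReal.tendsto_nhds_zero.1 h3 _ hκ2] with i hi hi3
  calc ∫⁻ t in Ioo 0 T, ‖ξ t (Φ i t) - ξ t (V t)‖ₑ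
      ≤ ∫⁻ t in Ioo 0 T,
          (ENNReal.ofReal K * ‖Φ i t - V t‖ₑ + ‖g t‖ₑ * ENNReal.ofReal δ) := by
        refine lintegral_mono_ae ?_
        filter_upwards [h, hK, hi] with t ht hKt hit
        rw [← map_sub, ht, integral_mul_eq_inner]
        refine (enorm_add_le _ _).trans ?_
        rw [← ofReal_norm, ← ofReal_norm, ← ofReal_norm, ← ofReal_norm,
          ← ENNReal.ofReal_mul' (norm_nonneg _), ← ENNReal.ofReal_mul (norm_nonneg _)]
        gcongr
        · exact (ζ t).le_of_opNorm_le hKt _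
        · exact (norm_inner_le_norm _ _).trans (by gcongr)
    _ = ENNReal.ofReal K * (∫⁻ t in Ioo 0 T, ‖Φ i t - V t‖ₑ) +
          (∫⁻ t in Ioo 0 T, ‖g t‖ₑ) * ENNReal.ofReal δ := by
        rw [lintegral_add_right' _ (hg.1.enorm.mul_const _),
          lintegral_const_mul' _ _ ENNReal.ofReal_ne_top,
          lintegral_mul_const' _ _ ENNReal.ofReal_ne_top]
    _ ≤ κ / 2 + κ / 2 := add_le_add hi3 hδκ
    _ = κ := ENNReal.add_halves κ

end TVFlow

/-! ### The limit of the backward averages -/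

theorem mainTheorem3 {N : ℕ} (hN : 2 ≤ N) (Ω : Opens (TVFlow.E N))
    (hΩ : Bornology.IsBounded (Ω : Set (TVFlow.E N))) (hlip : TVFlow.HasLipschitzBoundary Ω)
    {T : ℝ} (hT : 0 < T) (f : ℝ → TVFlow.L2 Ω) (hf : IntegrableOn f (Ioo 0 T)) (u₀ : TVFlow.L2 Ω)
    (u : ℝ → TVFlow.L2 Ω) (ξ : ℝ → StrongDual ℝ (TVFlow.BVL2 Ω))
    (hu : TVFlow.IsSolution Ω T f u₀ u ξ)
    (η : 𝓓(TVFlow.timeInterval T, ℝ)) (hη : ∀ t, 0 ≤ η t) :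
    (∀ ε > 0,
      (∀ t ∈ Ioo 0 T,
        TVFlow.PettisIntegrableOn (fun s => η s • TVFlow.toBV Ω (u s)) (Ioo (t - ε) t)) ∧
      IntegrableOn (fun t => ξ t (TVFlow.backwardAverage η u ε t)) (Ioo 0 T)) ∧
    Tendsto (fun ε => ∫ t in Ioo 0 T, ξ t (TVFlow.backwardAverage η u ε t)) (𝓝[>] 0)
      (𝓝 (- ∫ t in Ioo 0 T, deriv η t * ∫ x in (Ω : Set (TVFlow.E N)), 1 / 2 * u t x ^ 2)) := by
  open TVFlow TVFlow.BVL2 in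
  set V : ℝ → BVL2 Ω := fun s => η s • toBV Ω (u s) with hVdef
  have hη0 : ∀ t, t ∉ Ioo 0 T → η t = 0 := fun t ht =>
    image_eq_zero_of_notMem_tsupport fun h => ht (η.tsupport_subset h)
  have hηc : Continuous η := η.continuous
  have hV : Integrable V := by
    have h1 : IntegrableOn V (Ioo 0 T) := by
      obtain ⟨C, hC⟩ := hηc.bounded_above_of_compact_support η.hasCompactSupport
      exact hu.memL1.integrableOn.bdd_smul C hηc.aestronglyMeasurable (.of_forall hC)
    refine (integrableOn_iff_integrable_of_support_subset fun t ht => ?_).1 h1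
    by_contra h
    exact ht (by simp [hVdef, hη0 t h])
  -- the function `η u` as a continuous map to `L²(Ω)`
  set W : ℝ → L2 Ω := fun s => η s • u s with hWdef
  have hWc : Continuous W := by
    -- The support of `η` lies inside `(0,T)`, so the values of `u` outside `[0,T]` play no role.
    refine continuous_of_tsupport fun t ht => ?_
    have ht' : t ∈ Ioo 0 T := η.tsupport_subset (tsupport_smul_subset_left η u ht)
    exact hηc.continuousAt.smul (hu.continuousOn.continuousAt (Icc_mem_nhds ht'.1 ht'.2))
  have hWs : HasCompactSupport W := η.hasCompactSupport.smul_right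
  have hVW : ∀ᵐ s, toL2 (V s) = W s := by
    have h1 := (ae_restrict_iff' measurableSet_Ioo).1 hu.mem_bv
    filter_upwards [h1] with s hs
    rw [hVdef, map_smul]
    by_cases h : s ∈ Ioo 0 T
    · rw [toL2_toBV (hs h)]
    · simp [hWdef, hη0 s h]
  have hVWmean (ε t : ℝ) : toL2 (backwardMean ε V t) = backwardMean ε W t := by
    rw [backwardMean, map_smul, backwardMean, ← toL2L_apply,
      ← (toL2L Ω).integral_comp_comm hV.integrableOn]
    congr 1
    exact integral_congr_ae (ae_restrict_of_ae hVW)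
  have havg (ε t : ℝ) : backwardAverage η u ε t = backwardMean ε V t := by
    rw [backwardAverage, backwardMean,
      (hasPettisIntegral_integral hV.integrableOn).pettisIntegral_eq]
  have hint (ε : ℝ) (hε : 0 < ε) :
      IntegrableOn (fun t => ξ t (backwardMean ε V t)) (Ioo 0 T) := by
    -- The bound blows up as `ε → 0`, which is harmless: only integrability for fixed `ε` is needed.
    refine hu.mem_dual.integrableOn_apply ?_ (C := ε⁻¹ * ∫ s, ‖V s‖)
      (.of_forall fun t => (norm_toL2_le _).trans (norm_backwardMean_le hV hε t))
    exact (continuous_backwardMean hV hε).integrableOn_Icc.mono_set Ioo_subset_Icc_self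
  refine ⟨fun ε hε => ⟨fun t _ A _ _ => ⟨_, hasPettisIntegral_integral hV.integrableOn⟩, ?_⟩, ?_⟩
  · simp_rw [havg]
    exact hint ε hε
  have hVint : IntegrableOn (fun t => ξ t (V t)) (Ioo 0 T) := by
    obtain ⟨C, hC⟩ := hWc.bounded_above_of_compact_support hWs
    refine hu.mem_dual.integrableOn_apply hV.integrableOn (C := C) ?_
    filter_upwards [ae_restrict_of_ae hVW] with t ht
    rw [ht]
    exact hC t
  have hlim : ∫ t in Ioo 0 T, ξ t (V t) =
      - ∫ t in Ioo 0 T, deriv η t * ∫ x in (Ω : Set (E N)), 1 / 2 * u t x ^ 2 := by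
    rw [← hu.energy.2 η]
    simp [hVdef]
  rw [← hlim]
  simp_rw [havg]
  refine hu.mem_dual.tendsto_integral_apply ?_ hVint
    (tendsto_lintegral_enorm_backwardMean_sub hV 0 T) fun δ hδ => ?_
  · filter_upwards [self_mem_nhdsWithin] with ε hε using hint ε hε
  · filter_upwards [eventually_norm_backwardMean_sub_le
      (hWs.uniformContinuous_of_continuous hWc) hδ] with ε hε
    filter_upwards [ae_restrict_of_ae hVW] with t ht
    rw [map_sub, hVWmean, ht]
    exact hε t
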